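/- Let $V$ be a finite-dimensional vector space over $\mathbb R$ or over $\mathbb Q_p$ ($p$ a prime), with its unique Hausdorff vector space topology. A *contraction* of $V$ is a continuous automorphism $T$ of the topological group $(V,+)$ such that $T^n x\to 0$ for every $x\in V$. For a Borel probability measure $\mu$ on $V$ let $T(\mu)(B)=\mu(T^{-1}(B))$. Let $*$ denote convolution, and let $\nu^{n}$ be the $n$-th convolution power of $\nu$. Call $\mu$ *infinitely divisible* if for every integer $n\ge 1$ there is a Borel probability measure $\nu$ on $V$ with $\nu^{n}=\mu$. A Borel probability measure $\nu$ is a *factor* of $\mu$ if $\mu=\nu*\rho$ for some Borel probability measure $\rho$, and $\mu$ *has no idempotent factors* if the only factor $\nu$ of $\mu$ with $\nu*\nu=\nu$ is the Dirac measure $\delta_0$. Let $T_1,\dots,T_m$ be contractions of $V$ with $T_iT_j=T_jT_i$ for all $1\le i,j\le m$, and let $\mu$ be a Borel probability measure on $V$ such that $$\mu=T_1(\mu)*T_2(\mu)*\cdots*T_m(\mu)$$ (for $m=0$ the right-hand side is $\delta_0$). Then $\mu$ is infinitely divisible and has no idempotent factors. In particular, every autophage measure on $V$, that is, every Borel probability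 measure $\mu$ on $V$ such that $\mu=T(\mu)*S(\mu)$ for some contractions $T,S$ of $V$ with $TS=ST$, is infinitely divisible and has no idempotent factors. -/

import Mathlib

open MeasureTheory Filter Topology

namespace Autophage

/-- The topological additive group `V` is (the additive group of) a finite-dimensional vector
space over `ℝ` or over `ℚ_p` for some prime `p`, with its vector space topology
(for Hausdorff `V` the topology is then the unique Hausdorff vector space topology). -/
def IsFiniteDimRealOrPadic (V : Type*) [AddCommGroup V] [TopologicalSpace V] : Prop :=
  (∃ _ : Module ℝ V, ContinuousSMul ℝ V ∧ FiniteDimensional ℝ V) ∨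
  (∃ (p : ℕ) (_ : Fact p.Prime) (_ : Module ℚ_[p] V),
    ContinuousSMul ℚ_[p] V ∧ FiniteDimensional ℚ_[p] V)

section

variable {V : Type*} [AddCommGroup V] [TopologicalSpace V]

/-- A contraction: a continuous automorphism `T` of the topological group `V` (with continuous
inverse) such that `T ^ n x → 0` for every `x`. -/
def IsContraction (T : V ≃ₜ+ V) : Prop :=
  ∀ x : V, Tendsto (fun n : ℕ => (⇑T)^[n] x) atTop (𝓝 0)

end

section

variable {V : Type*} [AddCommGroup V] [MeasurableSpace V]

/-- The convolution `μ₁ ∗ ⋯ ∗ μₘ` of a list of measures; the empty convolution is the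
Dirac measure at `0`. -/
noncomputable def convList (l : List (Measure V)) : Measure V :=
  l.foldr (fun μ ν => μ ∗ ν) (Measure.dirac 0)

/-- The `n`-th convolution power of a measure. -/
noncomputable def convPow (μ : Measure V) (n : ℕ) : Measure V :=
  convList (List.replicate n μ)

/-- For every `n ≥ 1`, `μ` has an `n`-th convolution root among the probability measures. -/
def InfinitelyDivisible (μ : Measure V) : Prop :=
  ∀ n : ℕ, 1 ≤ n → ∃ ν : Measure V, IsProbabilityMeasure ν ∧ convPow ν n = μ

/-- `ν` is a factor of `μ`: `μ = ν ∗ ρ` for probability measures `ν`, `ρ`. -/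
def IsFactor (ν μ : Measure V) : Prop :=
  IsProbabilityMeasure ν ∧ ∃ ρ : Measure V, IsProbabilityMeasure ρ ∧ μ = ν ∗ ρ

/-- `μ` has no idempotent factors other than the trivial one, the Dirac measure at `0`. -/
def NoIdempotentFactors (μ : Measure V) : Prop :=
  ∀ ν : Measure V, IsFactor ν μ → ν ∗ ν = ν → ν = Measure.dirac 0

/-- `μ` is autophage: `μ = T(μ) ∗ S(μ)` for two commuting contractions `T`, `S`. -/
def IsAutophage [TopologicalSpace V] (μ : Measure V) : Prop :=
  ∃ T S : V ≃ₜ+ V, IsContraction T ∧ IsContraction S ∧ (∀ x, T (S x) = S (T x)) ∧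
    μ = μ.map T ∗ μ.map S

end

end Autophage

/-
Under convolution the probability measures form a commutative monoid, on which push-forward along
the `Tᵢ` gives commuting endomorphisms, and `μ` is a fixed point of their sum `S = ∑ Tᵢ`.

Divisibility: for a prime `q`, the Frobenius congruence `S ^ q ^ k = ∑ Tᵢ ^ q ^ k + q Q` gives
`μ = q • Q μ + ∑ Tᵢ ^ q ^ k μ`, where the last sum tends to `δ₀` as `k → ∞`. The approximate roots
`Q μ` are relatively compact, since factors of `μ` are so up to translation and multiplication by
`q` on `V` is proper. A limit point is a `q`-th root of `μ`, again fixed by `S`, so one can iterate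
over the prime factors of `n`.

Idempotent factors: the Fourier transform of `μ` has no zero, because a zero at `μ = ∑ Tᵢ μ` would
propagate to infinitely many of the measures `T^α μ`, which converge to `δ₀`. The Fourier transform
of an idempotent factor is therefore identically `1`.
-/

namespace Autophage

section ConvolutionMonoid

variable {V : Type*} [AddCommGroup V] [MeasurableSpace V]

noncomputable instance [MeasurableAdd₂ V] : Add (ProbabilityMeasure V) where
  add μ ν := ⟨(μ : Measure V) ∗ (ν : Measure V), inferInstance⟩

noncomputable instance : Zero (ProbabilityMeasure V) where
  zero := diracProba 0

variable [MeasurableAdd₂ V]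

noncomputable instance : AddCommMonoid (ProbabilityMeasure V) where
  add_assoc μ ν ρ := Subtype.ext (Measure.conv_assoc _ _ _)
  zero_add μ := Subtype.ext (Measure.dirac_zero_conv _)
  add_zero μ := Subtype.ext (Measure.conv_dirac_zero _)
  add_comm μ ν := Subtype.ext (Measure.conv_comm _ _)
  nsmul := nsmulRec

/-- `x ↦ δ_x` as a homomorphism into the convolution monoid. -/
noncomputable def diracHom : V →+ ProbabilityMeasure V where
  toFun := diracProba
  map_zero' := rfl
  map_add' x y := Subtype.ext (Measure.dirac_conv_dirac x y).symm

lemma toMeasure_add (μ ν : ProbabilityMeasure V) :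
    ((μ + ν : ProbabilityMeasure V) : Measure V) = (μ : Measure V) ∗ (ν : Measure V) := rfl

lemma toMeasure_add_diracHom (μ : ProbabilityMeasure V) (x : V) :
    ((μ + diracHom x : ProbabilityMeasure V) : Measure V) = (μ : Measure V).map (· + x) :=
  Measure.conv_dirac _ x

lemma add_diracHom_add_diracHom_neg (μ : ProbabilityMeasure V) (x : V) :
    μ + diracHom x + diracHom (-x) = μ := by
  rw [add_assoc, ← map_add, add_neg_cancel, map_zero, add_zero]

lemma convList_map_toMeasure (l : List (ProbabilityMeasure V)) :
    convList (l.map ProbabilityMeasure.toMeasure) = (l.sum : ProbabilityMeasure V) := by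
  induction l with
  | nil => rfl
  | cons μ l ih => rw [List.sum_cons, toMeasure_add, ← ih]; rfl

lemma convPow_toMeasure (ν : ProbabilityMeasure V) (n : ℕ) :
    convPow (ν : Measure V) n = (n • ν : ProbabilityMeasure V) := by
  rw [← List.sum_replicate, ← convList_map_toMeasure, List.map_replicate]; rfl

lemma infinitelyDivisible_toMeasure {μ : ProbabilityMeasure V}
    (h : ∀ n : ℕ, n ≠ 0 → ∃ σ : ProbabilityMeasure V, n • σ = μ) :
    InfinitelyDivisible (μ : Measure V) := by
  intro n hn
  obtain ⟨σ, hσ⟩ := h n (Nat.one_le_iff_ne_zero.1 hn)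
  exact ⟨σ, inferInstance, by rw [convPow_toMeasure, hσ]⟩

lemma noIdempotentFactors_toMeasure {μ : ProbabilityMeasure V}
    (h : ∀ ν ρ : ProbabilityMeasure V, ν + ρ = μ → ν + ν = ν → ν = 0) :
    NoIdempotentFactors (μ : Measure V) := by
  rintro ν ⟨hν, ρ, hρ, hμ⟩ hidem
  exact congrArg ProbabilityMeasure.toMeasure
    (h ⟨ν, hν⟩ ⟨ρ, hρ⟩ (Subtype.ext hμ.symm) (Subtype.ext hidem))

section Push

variable (G : Type*) [Monoid G] [DistribMulAction G V] [MeasurableConstSMul G V]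

/-- The push-forward action of `G` on the convolution monoid. It is not registered as a
`DistribMulAction` because for `G = ℕ` this would clash with convolution powers. -/
noncomputable def push : G →* AddMonoid.End (ProbabilityMeasure V) where
  toFun g :=
    { toFun μ := μ.map (f := (g • ·)) (measurable_const_smul g).aemeasurable
      map_zero' := Subtype.ext <|
        (Measure.map_dirac' (measurable_const_smul g) 0).trans (by rw [smul_zero]; rfl)
      map_add' _ _ := Subtype.ext <|
        Measure.map_conv_addMonoidHom (DistribSMul.toAddMonoidHom V g) (measurable_const_smul g) }
  map_one' := by
    ext1 μ
    refine Subtype.ext (?_ : (μ : Measure V).map ((1 : G) • ·) = μ)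
    simp only [one_smul, Measure.map_id']
  map_mul' g h := by
    ext1 μ
    refine Subtype.ext (?_ : (μ : Measure V).map ((g * h) • ·) =
      ((μ : Measure V).map (h • ·)).map (g • ·))
    rw [Measure.map_map (measurable_const_smul g) (measurable_const_smul h)]
    simp only [Function.comp_def, mul_smul]

variable {G}

lemma sum_push_apply {ι : Type*} [Fintype ι] (t : ι → G) (μ : ProbabilityMeasure V) :
    (∑ i, push G (t i)) μ = ∑ i, push G (t i) μ :=
  AddMonoidHom.finsetSum_apply _ _ _

lemma push_eq_sum_push_mul {ι : Type*} [Fintype ι] {t : ι → G} {μ : ProbabilityMeasure V}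
    (hμ : (∑ i, push G (t i)) μ = μ) (g : G) : push G g μ = ∑ i, push G (g * t i) μ := by
  conv_lhs => rw [← hμ, sum_push_apply, map_sum]
  simp only [map_mul]
  rfl

lemma toMeasure_sum_push {m : ℕ} (t : Fin m → G) (μ : ProbabilityMeasure V) :
    ((∑ i, push G (t i)) μ : ProbabilityMeasure V) =
      convList (List.ofFn fun i => (μ : Measure V).map (t i • ·)) := by
  rw [sum_push_apply, ← List.sum_ofFn, ← convList_map_toMeasure, List.map_ofFn]
  rfl

end Push

end ConvolutionMonoid

section WeakConvergence

lemma tendsto_map_of_forall_tendsto {X Y ι : Type*} [MeasurableSpace X] [TopologicalSpace Y]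
    [MeasurableSpace Y] [OpensMeasurableSpace Y] (μ : ProbabilityMeasure X) {l : Filter ι}
    [l.IsCountablyGenerated] {f : ι → X → Y} {f₀ : X → Y} (hf : ∀ i, Measurable (f i))
    (hf₀ : Measurable f₀) (h : ∀ x, Tendsto (fun i => f i x) l (𝓝 (f₀ x))) :
    Tendsto (fun i => μ.map (hf i).aemeasurable) l (𝓝 (μ.map hf₀.aemeasurable)) := by
  refine ProbabilityMeasure.tendsto_iff_forall_integral_tendsto.2 fun φ => ?_
  have hmap : ∀ g : X → Y, (hg : Measurable g) →
      ∫ y, φ y ∂(μ.map hg.aemeasurable : Measure Y) = ∫ x, φ (g x) ∂(μ : Measure X) :=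
    fun g hg => integral_map hg.aemeasurable φ.continuous.measurable.aestronglyMeasurable
  simp only [hmap _ (hf _), hmap _ hf₀]
  refine tendsto_integral_filter_of_dominated_convergence (fun _ => ‖φ‖)
    (.of_forall fun i => (φ.continuous.measurable.comp (hf i)).aestronglyMeasurable)
    (.of_forall fun i => .of_forall fun x => φ.norm_coe_le_norm _) (integrable_const _)
    (.of_forall fun x => (φ.continuous.tendsto _).comp (h x))

variable {V : Type*} [AddCommGroup V] [MeasurableSpace V] [TopologicalSpace V] [BorelSpace V]
  [IsTopologicalAddGroup V] [SecondCountableTopology V]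

lemma tendsto_push_zero {G ι : Type*} [Monoid G] [DistribMulAction G V] [MeasurableConstSMul G V]
    {l : Filter ι} [l.IsCountablyGenerated] {g : ι → G}
    (h : ∀ x : V, Tendsto (fun i => g i • x) l (𝓝 0)) (μ : ProbabilityMeasure V) :
    Tendsto (fun i => push G (g i) μ) l (𝓝 0) := by
  have h₀ : μ.map (f := fun _ => (0 : V)) aemeasurable_const = 0 :=
    Subtype.ext <| (Measure.map_const _ _).trans (by rw [measure_univ, one_smul]; rfl)
  exact h₀ ▸ tendsto_map_of_forall_tendsto μ (fun i => measurable_const_smul (g i))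
    measurable_const h

instance [TopologicalSpace.PseudoMetrizableSpace V] : ContinuousAdd (ProbabilityMeasure V) where
  continuous_add := (ProbabilityMeasure.continuous_map (f := fun p : V × V => p.1 + p.2)
    (by fun_prop)).comp ProbabilityMeasure.continuous_prod

end WeakConvergence

section Tightness

open scoped ENNReal Pointwise

variable {X : Type*} [TopologicalSpace X] [MeasurableSpace X]

/-- A function tending to infinity at infinity and integrable with respect to a given measure
bounds that measure and all others with the same integral simultaneously. -/
def IsTightnessFunction (Φ : X → ℝ≥0∞) : Prop :=
  Measurable Φ ∧ ∀ c ≠ ∞, ∃ K, IsCompact K ∧ ∀ x ∉ K, c ≤ Φ x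

lemma IsTightnessFunction.isTightMeasureSet {Φ : X → ℝ≥0∞} (hΦ : IsTightnessFunction Φ)
    {C : ℝ≥0∞} (hC : C ≠ ∞) : IsTightMeasureSet {σ : Measure X | ∫⁻ x, Φ x ∂σ ≤ C} := by
  refine isTightMeasureSet_iff_exists_isCompact_measure_compl_le.2 fun ε hε => ?_
  obtain ⟨N, hN⟩ := ENNReal.exists_nat_gt (ENNReal.div_ne_top hC hε.ne')
  have hN₀ : (N : ℝ≥0∞) ≠ 0 := (bot_le.trans_lt hN).ne'
  obtain ⟨K, hK, hΦK⟩ := hΦ.2 N (ENNReal.natCast_ne_top N)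
  refine ⟨K, hK, fun σ hσ => ?_⟩
  calc σ Kᶜ ≤ σ {x | (N : ℝ≥0∞) ≤ Φ x} := measure_mono hΦK
    _ ≤ (∫⁻ x, Φ x ∂σ) / N := meas_ge_le_lintegral_div hΦ.1.aemeasurable
        hN₀ (ENNReal.natCast_ne_top N)
    _ ≤ C / N := by gcongr; exact hσ
    _ ≤ ε := ENNReal.div_le_of_le_mul'
        ((ENNReal.div_le_iff_le_mul (.inl hε.ne') (.inr hN₀)).1 hN.le)

variable [BorelSpace X] [PolishSpace X]

lemma exists_isTightnessFunction (μ : Measure X) [IsFiniteMeasure μ] :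
    ∃ Φ : X → ℝ≥0∞, IsTightnessFunction Φ ∧ ∫⁻ x, Φ x ∂μ ≠ ∞ := by
  obtain ⟨ε, hε, hsum⟩ := ENNReal.exists_pos_sum_of_countable' one_ne_zero ℕ
  choose K hK hμK using fun n =>
    isTightMeasureSet_iff_exists_isCompact_measure_compl_le.1
      (isTightMeasureSet_singleton (μ := μ)) (ε n) (hε n)
  have hmeas : ∀ n, MeasurableSet (K n)ᶜ := fun n => (hK n).measurableSet.compl
  have hind : ∀ n, Measurable ((K n)ᶜ.indicator (1 : X → ℝ≥0∞)) :=
    fun n => measurable_one.indicator (hmeas n)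
  refine ⟨fun x => ∑' n, (K n)ᶜ.indicator 1 x, ⟨Measurable.tsum hind, fun c hc => ?_⟩,
    ne_top_of_le_ne_top ENNReal.one_ne_top ?_⟩
  · obtain ⟨N, hN⟩ := ENNReal.exists_nat_gt hc
    refine ⟨⋃ n ∈ Finset.range N, K n, (Finset.range N).isCompact_biUnion fun n _ => hK n,
      fun x hx => hN.le.trans ?_⟩
    have hx1 : ∀ n ∈ Finset.range N, (K n)ᶜ.indicator (1 : X → ℝ≥0∞) x = 1 := fun n hn =>
      Set.indicator_of_mem (s := (K n)ᶜ) (fun h => hx (Set.mem_iUnion₂_of_mem hn h)) _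
    calc (N : ℝ≥0∞) = ∑ n ∈ Finset.range N, (K n)ᶜ.indicator (1 : X → ℝ≥0∞) x := by
          rw [Finset.sum_congr rfl hx1]; simp
      _ ≤ _ := ENNReal.sum_le_tsum _
  · calc ∫⁻ x, ∑' n, (K n)ᶜ.indicator 1 x ∂μ = ∑' n, μ (K n)ᶜ := by
          rw [lintegral_tsum fun n => (hind n).aemeasurable]
          simp only [lintegral_indicator_one (hmeas _)]
      _ ≤ ∑' n, ε n := ENNReal.tsum_le_tsum fun n => hμK n μ rfl
      _ ≤ 1 := hsum.le

variable [AddCommGroup X] [IsTopologicalAddGroup X]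

/-- If `Φ` is a tightness function with `∫ Φ ∂(ν ∗ ρ) < ∞`, then averaging over `y` with respect
to `ρ` yields a translate of `ν` under which the integral of `Φ` is at most `∫ Φ ∂(ν ∗ ρ)`. -/
lemma exists_isCompact_add_diracHom_mem (μ : ProbabilityMeasure X) :
    ∃ D : Set (ProbabilityMeasure X), IsCompact D ∧
      ∀ ν ρ : ProbabilityMeasure X, ν + ρ = μ → ∃ x, ν + diracHom x ∈ D := by
  obtain ⟨Φ, hΦ, hΦμ⟩ := exists_isTightnessFunction (μ : Measure X)
  refine ⟨closure {σ | ∫⁻ x, Φ x ∂(σ : Measure X) ≤ ∫⁻ x, Φ x ∂(μ : Measure X)},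
    isCompact_closure_of_isTightMeasureSet <| (hΦ.isTightMeasureSet hΦμ).subset ?_,
    fun ν ρ h => ?_⟩
  · rintro _ ⟨σ, hσ, rfl⟩
    exact hσ
  · have hm : Measurable fun p : X × X => Φ (p.1 + p.2) := hΦ.1.comp measurable_add
    obtain ⟨y, hy⟩ := exists_le_lintegral (μ := (ρ : Measure X))
      (f := fun y => ∫⁻ x, Φ (x + y) ∂(ν : Measure X)) hm.lintegral_prod_left'.aemeasurable
    refine ⟨y, subset_closure ?_⟩
    calc ∫⁻ z, Φ z ∂(ν + diracHom y : ProbabilityMeasure X)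
        = ∫⁻ x, Φ (x + y) ∂(ν : Measure X) := by
          rw [toMeasure_add_diracHom, lintegral_map hΦ.1 (measurable_add_const y)]
      _ ≤ ∫⁻ y, ∫⁻ x, Φ (x + y) ∂(ν : Measure X) ∂(ρ : Measure X) := hy
      _ = ∫⁻ x, ∫⁻ y, Φ (x + y) ∂(ρ : Measure X) ∂(ν : Measure X) :=
        (lintegral_lintegral_swap hm.aemeasurable).symm
      _ = ∫⁻ z, Φ z ∂(μ : Measure X) := by rw [← h, toMeasure_add, Measure.lintegral_conv hΦ.1]

lemma isProperMap_add_diracHom (μ : ProbabilityMeasure X) :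
    IsProperMap fun x => μ + diracHom x := by
  have hcont : Continuous fun x => μ + diracHom x := continuous_const.add continuous_diracProba
  refine isProperMap_iff_isCompact_preimage.2 ⟨hcont, fun D hD => ?_⟩
  let _ := TopologicalSpace.upgradeIsCompletelyMetrizable X
  obtain ⟨K, hK, hDK⟩ := isTightMeasureSet_iff_exists_isCompact_measure_compl_le.1
    (isTightMeasureSet_of_isCompact_closure (hD.closure_of_subset subset_rfl)) 3⁻¹ (by simp)
  obtain ⟨L, hL, hμL⟩ := isTightMeasureSet_iff_exists_isCompact_measure_compl_le.1
    (isTightMeasureSet_singleton (μ := (μ : Measure X))) 3⁻¹ (by simp)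
  refine (hK.add hL.neg).of_isClosed_subset (hD.isClosed.preimage hcont) fun x hx => ?_
  obtain ⟨y, hyL, hyK⟩ : ∃ y ∈ L, y + x ∈ K := by
    by_contra! hLK
    have hμL' : (μ : Measure X) L ≤ 3⁻¹ := calc
      (μ : Measure X) L ≤ (μ : Measure X) ((· + x) ⁻¹' Kᶜ) := measure_mono hLK
      _ = ((μ + diracHom x : ProbabilityMeasure X) : Measure X) Kᶜ := by
        rw [toMeasure_add_diracHom,
          Measure.map_apply (measurable_add_const x) hK.measurableSet.compl]
      _ ≤ 3⁻¹ := hDK _ ⟨_, hx, rfl⟩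
    have := calc
      1 = (μ : Measure X) L + (μ : Measure X) Lᶜ := (prob_add_prob_compl hL.measurableSet).symm
      _ ≤ 3⁻¹ + 3⁻¹ := add_le_add hμL' (hμL _ rfl)
      _ < 3⁻¹ + 3⁻¹ + 3⁻¹ := ENNReal.lt_add_right (by simp) (by simp)
      _ = 1 := ENNReal.inv_three_add_inv_three
    exact this.false
  exact ⟨y + x, hyK, -y, Set.neg_mem_neg.2 hyL, by simp⟩

end Tightness

section Divisibility

lemma exists_sum_pow_prime_pow_eq {A ι : Type*} [CommSemiring A] {q : ℕ} (hq : q.Prime) (k : ℕ)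
    (s : Finset ι) (a : ι → A) :
    ∃ Q : A, (∑ i ∈ s, a i) ^ q ^ k = ∑ i ∈ s, a i ^ q ^ k + q * Q := by
  classical
  induction s using Finset.induction_on with
  | empty => exact ⟨0, by simp [hq.ne_zero]⟩
  | insert j s hj ih =>
    obtain ⟨Q, hQ⟩ := ih
    obtain ⟨r, hr⟩ := exists_add_pow_prime_pow_eq hq (a j) (∑ i ∈ s, a i) k
    refine ⟨Q + a j * (∑ i ∈ s, a i) * r, ?_⟩
    rw [Finset.sum_insert hj, Finset.sum_insert hj, hr, hQ]
    ring

/-- `R` need not be commutative: the Frobenius congruence is transferred from the monoid algebra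
of `G`. -/
lemma exists_commute_sum_map_pow_prime_pow_eq {G R ι : Type*} [CommMonoid G] [Semiring R]
    (f : G →* R) {q : ℕ} (hq : q.Prime) (k : ℕ) (s : Finset ι) (g : ι → G) :
    ∃ Q : R, Commute (∑ i ∈ s, f (g i)) Q ∧
      (∑ i ∈ s, f (g i)) ^ q ^ k = ∑ i ∈ s, f (g i ^ q ^ k) + q * Q := by
  let F := MonoidAlgebra.lift ℕ R G f
  have hF : ∀ h, F (MonoidAlgebra.of ℕ G h) = f h := MonoidAlgebra.lift_of f
  obtain ⟨Q, hQ⟩ := exists_sum_pow_prime_pow_eq hq k s fun i => MonoidAlgebra.of ℕ G (g i)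
  refine ⟨F Q, ?_, ?_⟩
  · simpa only [map_sum, hF] using (Commute.all (∑ i ∈ s, MonoidAlgebra.of ℕ G (g i)) Q).map F
  · simpa only [map_sum, map_pow, map_add, map_mul, map_natCast, hF] using congrArg F hQ

variable {V : Type*} [AddCommGroup V] [TopologicalSpace V] [IsTopologicalAddGroup V]
  [MeasurableSpace V] [BorelSpace V] [PolishSpace V]

theorem exists_mem_closure_range_nsmul_eq {n : ℕ} (hn : n ≠ 0)
    (hproper : IsProperMap fun x : V => n • x) {ι : Type*} {l : Filter ι} [l.NeBot]
    {μ : ProbabilityMeasure V} {ν ρ : ι → ProbabilityMeasure V}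
    (h : ∀ k, n • ν k + ρ k = μ) (hρ : Tendsto ρ l (𝓝 0)) :
    ∃ σ ∈ closure (Set.range ν), n • σ = μ := by
  obtain ⟨D, hD, hμD⟩ := exists_isCompact_add_diracHom_mem μ
  have hfactor : ∀ k, ∃ ρ' : ProbabilityMeasure V, ν k + ρ' = μ := fun k =>
    ⟨(n - 1) • ν k + ρ k, by
      rw [← add_assoc, ← succ_nsmul', Nat.sub_add_cancel (Nat.one_le_iff_ne_zero.2 hn), h]⟩
  choose x hx using fun k => (hfactor k).elim (hμD (ν k))
  let 𝒰 : Ultrafilter ι := .of l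
  have hρ𝒰 : Tendsto ρ 𝒰 (𝓝 0) := hρ.mono_left (Ultrafilter.of_le l)
  obtain ⟨τ, -, hτ⟩ : ∃ τ ∈ D, Tendsto (fun k => ν k + diracHom (x k)) 𝒰 (𝓝 τ) :=
    hD.ultrafilter_le_nhds' (𝒰.map _) (mem_map.2 (univ_mem' hx))
  obtain ⟨y, -, hy⟩ : ∃ y, _ ∧ Tendsto x 𝒰 (𝓝 y) := by
    refine ((isProperMap_add_diracHom μ).comp hproper).ultrafilter_le_nhds_of_tendsto
      (𝒰 := 𝒰.map x) (y := n • τ) ?_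
    have := (((continuous_nsmul n).tendsto τ).comp hτ).add hρ𝒰
    refine tendsto_map' ((add_zero (n • τ) ▸ this).congr fun k => ?_)
    simp only [Function.comp_apply, nsmul_add, map_nsmul, ← h k]
    exact add_right_comm _ _ _
  have hν : Tendsto ν 𝒰 (𝓝 (τ + diracHom (-y))) := by
    refine (hτ.add ((continuous_diracProba.tendsto _).comp hy.neg)).congr fun k => ?_
    exact add_diracHom_add_diracHom_neg (ν k) (x k)
  refine ⟨_, mem_closure_of_tendsto hν (.of_forall Set.mem_range_self), ?_⟩
  have := (((continuous_nsmul n).tendsto _).comp hν).add hρ𝒰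
  simp only [Function.comp_def, h, add_zero] at this
  exact tendsto_nhds_unique this tendsto_const_nhds

variable {G ι : Type*} [CommMonoid G] [DistribMulAction G V] [ContinuousConstSMul G V]
  [Fintype ι] {t : ι → G}

lemma continuous_sum_push (t : ι → G) :
    Continuous fun μ : ProbabilityMeasure V => (∑ i, push G (t i)) μ := by
  simp only [sum_push_apply]
  exact continuous_finsetSum _ fun i _ =>
    ProbabilityMeasure.continuous_map (continuous_const_smul (t i))

lemma exists_prime_nsmul_eq (ht : ∀ i (x : V), Tendsto (fun n => t i ^ n • x) atTop (𝓝 0))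
    {q : ℕ} (hq : q.Prime) (hproper : IsProperMap fun x : V => q • x) {μ : ProbabilityMeasure V}
    (hμ : (∑ i, push G (t i)) μ = μ) :
    ∃ σ : ProbabilityMeasure V, (∑ i, push G (t i)) σ = σ ∧ q • σ = μ := by
  set S : AddMonoid.End (ProbabilityMeasure V) := ∑ i, push G (t i)
  choose Q hcomm hQ using fun k =>
    exists_commute_sum_map_pow_prime_pow_eq (push G (V := V)) hq k Finset.univ t
  have hSμ : ∀ N, (S ^ N) μ = μ := fun N => by
    rw [AddMonoid.End.coe_pow]; exact Function.iterate_fixed hμ N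
  have hroot : ∀ k, q • Q k μ + (∑ i, push G (t i ^ q ^ k)) μ = μ := fun k => by
    have := DFunLike.congr_fun (hQ k) μ
    rw [hSμ] at this
    exact (add_comm _ _).trans this.symm
  have hrem : Tendsto (fun k => (∑ i, push G (t i ^ q ^ k)) μ) atTop (𝓝 0) := by
    simp only [sum_push_apply]
    rw [← Finset.sum_const_zero (ι := ι) (s := Finset.univ)]
    refine tendsto_finsetSum _ fun i _ => tendsto_push_zero (fun x => ?_) μ
    exact (ht i x).comp (tendsto_pow_atTop_atTop_of_one_lt hq.one_lt)
  obtain ⟨σ, hσ, hσμ⟩ := exists_mem_closure_range_nsmul_eq hq.ne_zero hproper hroot hrem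
  refine ⟨σ, ?_, hσμ⟩
  have hclosed : IsClosed {τ | S τ = τ} := isClosed_eq (continuous_sum_push t) continuous_id
  refine closure_minimal ?_ hclosed hσ
  rintro _ ⟨k, rfl⟩
  calc S (Q k μ) = Q k (S μ) := DFunLike.congr_fun (hcomm k) μ
    _ = Q k μ := by rw [hμ]

theorem exists_nsmul_eq (ht : ∀ i (x : V), Tendsto (fun n => t i ^ n • x) atTop (𝓝 0))
    (hproper : ∀ q : ℕ, q.Prime → IsProperMap fun x : V => q • x) {n : ℕ} (hn : n ≠ 0)
    {μ : ProbabilityMeasure V} (hμ : (∑ i, push G (t i)) μ = μ) :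
    ∃ σ : ProbabilityMeasure V, n • σ = μ := by
  induction n using induction_on_primes generalizing μ with
  | zero => exact absurd rfl hn
  | one => exact ⟨μ, one_smul ℕ μ⟩
  | prime_mul q n hq ih =>
    obtain ⟨σ, hσ, hσμ⟩ := exists_prime_nsmul_eq ht hq (hproper q hq) hμ
    obtain ⟨τ, hτ⟩ := ih (right_ne_zero_of_mul hn) hσ
    exact ⟨τ, by rw [mul_smul, hτ, hσμ]⟩

end Divisibility

section Equicontinuity

variable {V : Type*} [AddCommGroup V] [TopologicalSpace V] [IsTopologicalAddGroup V] [BaireSpace V]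

/-- The Banach–Steinhaus theorem for homomorphisms from a Baire group: by Baire, some closed set
`{x | ∀ n ≥ N, f n x ∈ C}` has interior, and differences of its points form a neighbourhood of
`0`. -/
lemma eventually_nhds_zero_forall_mem_of_tendsto {W : Type*} [AddCommGroup W] [TopologicalSpace W]
    [IsTopologicalAddGroup W] {f : ℕ → V →+ W} (hcont : ∀ n, Continuous (f n))
    (hf : ∀ x, Tendsto (fun n => f n x) atTop (𝓝 0)) {U : Set W} (hU : U ∈ 𝓝 0) :
    ∀ᶠ x in 𝓝 0, ∀ n, f n x ∈ U := by
  obtain ⟨U', hU', hsub⟩ := exists_nhds_half_neg hU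
  obtain ⟨C, hC, hCclosed, hCU'⟩ := exists_mem_nhds_isClosed_subset hU'
  let A : ℕ → Set V := fun N => ⋂ n ≥ N, f n ⁻¹' C
  have hA : ⋃ N, A N = Set.univ := Set.eq_univ_of_forall fun x => by
    obtain ⟨N, hN⟩ := eventually_atTop.1 ((hf x).eventually hC)
    exact Set.mem_iUnion.2 ⟨N, Set.mem_iInter₂.2 hN⟩
  obtain ⟨N, y, hy⟩ := nonempty_interior_of_iUnion_of_closed
    (fun N => isClosed_biInter fun n _ => hCclosed.preimage (hcont n)) hA
  have hlarge : ∀ᶠ x in 𝓝 (0 : V), ∀ n ≥ N, f n x ∈ U := by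
    have hmem : ∀ᶠ x in 𝓝 (0 : V), x + y ∈ A N :=
      (continuous_add_const y).continuousAt.eventually_mem
        (by rw [zero_add]; exact mem_interior_iff_mem_nhds.1 hy)
    filter_upwards [hmem] with x hx n hn
    have hxC := Set.mem_iInter₂.1 hx n hn
    have hyC := Set.mem_iInter₂.1 (interior_subset hy) n hn
    simpa using hsub _ (hCU' hxC) _ (hCU' hyC)
  have hsmall : ∀ᶠ x in 𝓝 (0 : V), ∀ n ∈ Set.Iio N, f n x ∈ U :=
    (Set.finite_Iio N).eventually_all.2 fun n _ =>
      (hcont n).continuousAt.eventually_mem (by simpa using hU)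
  filter_upwards [hlarge, hsmall] with x hx hx' n
  exact (lt_or_ge n N).elim (hx' n) (hx n)

variable {G ι : Type*} [CommMonoid G] [DistribMulAction G V] [ContinuousConstSMul G V] {t : ι → G}

lemma eventually_nhds_zero_forall_prod_pow_smul_mem
    (ht : ∀ i (x : V), Tendsto (fun n => t i ^ n • x) atTop (𝓝 0)) (s : Finset ι) {U : Set V}
    (hU : U ∈ 𝓝 0) : ∀ᶠ x in 𝓝 (0 : V), ∀ α : ι → ℕ, (∏ i ∈ s, t i ^ α i) • x ∈ U := by
  classical
  induction s using Finset.induction_on generalizing U with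
  | empty => simpa using hU
  | insert j s hj ih =>
    have hpow := eventually_nhds_zero_forall_mem_of_tendsto
      (f := fun n => DistribSMul.toAddMonoidHom V (t j ^ n)) (fun n => continuous_const_smul _)
      (ht j) hU
    filter_upwards [ih hpow] with x hx α
    rw [Finset.prod_insert hj, mul_smul]
    exact hx α (α j)

theorem tendsto_prod_pow_smul_cofinite [Fintype ι]
    (ht : ∀ i (x : V), Tendsto (fun n => t i ^ n • x) atTop (𝓝 0)) (x : V) :
    Tendsto (fun α : ι → ℕ => (∏ i, t i ^ α i) • x) cofinite (𝓝 0) := by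
  classical
  intro U hU
  have hcoord : ∀ i, ∀ᶠ n in atTop, ∀ α : ι → ℕ,
      (∏ j ∈ Finset.univ.erase i, t j ^ α j) • t i ^ n • x ∈ U := fun i =>
    (ht i x).eventually (eventually_nhds_zero_forall_prod_pow_smul_mem ht _ hU)
  rw [mem_map, ← coprodᵢ_cofinite, mem_coprodᵢ_iff]
  refine fun i => ⟨_, Nat.cofinite_eq_atTop ▸ hcoord i, fun α hα => ?_⟩
  simpa only [Set.mem_preimage, ← Finset.prod_erase_mul _ _ (Finset.mem_univ i), mul_smul]
    using hα α

end Equicontinuity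

section Characters

variable {V : Type*} [AddCommGroup V] [MeasurableSpace V]

/-- The Fourier transform of a probability measure at a unitary character. -/
noncomputable def characterIntegral (χ : AddChar V Circle) (μ : ProbabilityMeasure V) : ℂ :=
  ∫ x, (χ x : ℂ) ∂(μ : Measure V)

variable {χ : AddChar V Circle}

lemma ae_eq_one_of_characterIntegral_eq_one {ν : ProbabilityMeasure V}
    (h : characterIntegral χ ν = 1) : ∀ᵐ x ∂(ν : Measure V), χ x = 1 := by
  have hle : ∀ᵐ x ∂(ν : Measure V), ‖(χ x : ℂ)‖ ≤ 1 := .of_forall fun x => (Circle.norm_coe _).le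
  rcases ae_eq_const_or_norm_integral_lt_of_norm_le_const hle with hconst | hlt
  · rw [average_eq_integral, ← characterIntegral, h] at hconst
    exact hconst.mono fun x hx => Circle.ext hx
  · rw [← characterIntegral, h] at hlt
    simp at hlt

variable [TopologicalSpace V]

theorem eq_zero_of_forall_characterIntegral_eq_one [SecondCountableTopology V]
    (hsep : ∀ x : V, x ≠ 0 → ∃ χ : AddChar V Circle, Continuous χ ∧ χ x ≠ 1)
    {ν : ProbabilityMeasure V}
    (hν : ∀ χ : AddChar V Circle, Continuous χ → characterIntegral χ ν = 1) : ν = 0 := by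
  have hcompl : (ν : Measure V) {0}ᶜ = 0 := by
    refine measure_null_of_locally_null _ fun x hx => ?_
    obtain ⟨χ, hχ, hχx⟩ := hsep x hx
    exact ⟨{y | χ y ≠ 1}, mem_nhdsWithin_of_mem_nhds <|
      (isOpen_ne_fun hχ continuous_const).mem_nhds hχx,
      ae_eq_one_of_characterIntegral_eq_one (hν χ hχ)⟩
  have hae : (id : V → V) =ᵐ[(ν : Measure V)] fun _ => 0 := hcompl
  refine Subtype.ext ?_
  calc (ν : Measure V) = (ν : Measure V).map id := Measure.map_id.symm
    _ = (ν : Measure V).map fun _ => 0 := Measure.map_congr hae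
    _ = Measure.dirac 0 := by rw [Measure.map_const, measure_univ, one_smul]

variable [BorelSpace V]

lemma characterIntegral_zero (hχ : Continuous χ) : characterIntegral χ 0 = 1 := by
  have hm : StronglyMeasurable fun x => (χ x : ℂ) :=
    (continuous_subtype_val.comp hχ).stronglyMeasurable
  exact (integral_dirac' _ _ hm).trans (by simp)

lemma continuous_characterIntegral (hχ : Continuous χ) :
    Continuous (characterIntegral χ) := by
  let φ : BoundedContinuousFunction V ℂ := .ofNormedAddCommGroup (fun x => (χ x : ℂ))
    (continuous_subtype_val.comp hχ) 1 fun x => (Circle.norm_coe _).le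
  exact continuous_iff_continuousAt.2 fun μ =>
    (ProbabilityMeasure.tendsto_iff_forall_integral_rclike_tendsto ℂ).1 tendsto_id φ

variable [IsTopologicalAddGroup V] [SecondCountableTopology V]

lemma characterIntegral_add (hχ : Continuous χ) (μ ν : ProbabilityMeasure V) :
    characterIntegral χ (μ + ν) = characterIntegral χ μ * characterIntegral χ ν := by
  have hint : Integrable (fun x => (χ x : ℂ)) ((μ + ν : ProbabilityMeasure V) : Measure V) :=
    .of_bound (continuous_subtype_val.comp hχ).measurable.aestronglyMeasurable 1
      (.of_forall fun x => (Circle.norm_coe _).le)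
  rw [characterIntegral, toMeasure_add, integral_conv hint]
  simp only [AddChar.map_add_eq_mul, Circle.coe_mul, integral_const_mul, integral_mul_const]
  rfl

lemma characterIntegral_sum (hχ : Continuous χ) {ι : Type*} (s : Finset ι)
    (μ : ι → ProbabilityMeasure V) :
    characterIntegral χ (∑ i ∈ s, μ i) = ∏ i ∈ s, characterIntegral χ (μ i) := by
  classical
  induction s using Finset.induction_on with
  | empty => exact characterIntegral_zero hχ
  | insert a s ha ih =>
    rw [Finset.sum_insert ha, Finset.prod_insert ha, characterIntegral_add hχ, ih]

theorem eq_zero_of_add_self_of_characterIntegral_ne_zero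
    (hsep : ∀ x : V, x ≠ 0 → ∃ χ : AddChar V Circle, Continuous χ ∧ χ x ≠ 1)
    {ν ρ : ProbabilityMeasure V}
    (h : ∀ χ : AddChar V Circle, Continuous χ → characterIntegral χ (ν + ρ) ≠ 0)
    (hν : ν + ν = ν) : ν = 0 := by
  refine eq_zero_of_forall_characterIntegral_eq_one hsep fun χ hχ => ?_
  have hne : characterIntegral χ ν ≠ 0 :=
    left_ne_zero_of_mul (characterIntegral_add hχ ν ρ ▸ h χ hχ)
  exact (mul_eq_left₀ hne).1 ((characterIntegral_add hχ ν ν).symm.trans (by rw [hν]))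

variable {G ι : Type*} [CommMonoid G] [DistribMulAction G V] [ContinuousConstSMul G V]
  [Fintype ι] {t : ι → G} {μ : ProbabilityMeasure V}

theorem characterIntegral_ne_zero [BaireSpace V]
    (ht : ∀ i (x : V), Tendsto (fun n => t i ^ n • x) atTop (𝓝 0))
    (hμ : (∑ i, push G (t i)) μ = μ) (hχ : Continuous χ) : characterIntegral χ μ ≠ 0 := by
  classical
  intro h
  let Z : Set (ι → ℕ) := {α | characterIntegral χ (push G (∏ i, t i ^ α i) μ) = 0}
  have hZ₀ : 0 ∈ Z := by simpa [Z] using h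
  have hprod (α : ι → ℕ) (i : ι) :
      ∏ j, t j ^ (α + Pi.single i 1 : ι → ℕ) j = (∏ j, t j ^ α j) * t i := by
    simp_rw [Pi.add_apply, pow_add, Finset.prod_mul_distrib]
    simp [Pi.single_apply, pow_ite]
  have hstep : ∀ α ∈ Z, ∃ i, α + Pi.single i 1 ∈ Z := fun α hα => by
    rw [Set.mem_ofPred_eq, push_eq_sum_push_mul hμ, characterIntegral_sum hχ,
      Finset.prod_eq_zero_iff] at hα
    obtain ⟨i, -, hi⟩ := hα
    exact ⟨i, by rwa [Set.mem_ofPred_eq, hprod]⟩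
  have hZ : Z.Finite := Set.not_infinite.1 fun hinf => by
    let α := hinf.natEmbedding
    have hα : Tendsto (fun n => (α n : ι → ℕ)) atTop cofinite := by
      rw [← Nat.cofinite_eq_atTop]
      exact (Subtype.val_injective.comp α.injective).tendsto_cofinite
    have hlim := tendsto_push_zero (fun x => (tendsto_prod_pow_smul_cofinite ht x).comp hα) μ
    have hlim' := ((continuous_characterIntegral hχ).tendsto 0).comp hlim
    rw [characterIntegral_zero hχ] at hlim'
    exact zero_ne_one (tendsto_nhds_unique
      (tendsto_const_nhds.congr fun n => (α n).2.symm) hlim')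
  obtain ⟨α, hα⟩ := hZ.exists_maximal ⟨0, hZ₀⟩
  obtain ⟨i, hi⟩ := hstep α hα.prop
  have := congrFun (hα.eq_of_le hi (le_add_of_nonneg_right (Pi.single_nonneg.2 zero_le_one))) i
  simp at this

end Characters

section SeparatingCharacters

/-- The embedding `ℚ/ℤ → ℝ/ℤ`, which turns `ℚ/ℤ`-valued characters into unitary ones. -/
noncomputable def ratCircleToReal : AddCircle (1 : ℚ) →+ AddCircle (1 : ℝ) :=
  QuotientAddGroup.map _ _ (Rat.castHom ℝ : ℚ →+ ℝ) <| by
    rintro _ ⟨n, rfl⟩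
    exact ⟨n, by simp⟩

lemma ratCircleToReal_injective : Function.Injective ratCircleToReal := by
  refine (injective_iff_map_eq_zero _).2 fun x => ?_
  induction x using QuotientAddGroup.induction_on with
  | H q =>
    intro h
    obtain ⟨n, hn⟩ := (AddCircle.coe_eq_zero_iff (1 : ℝ)).1 h
    refine (AddCircle.coe_eq_zero_iff 1).2 ⟨n, Rat.cast_injective (α := ℝ) ?_⟩
    simpa using hn

lemma exists_addChar_ne_one_of_isOpen {W : Type*} [AddCommGroup W] [TopologicalSpace W]
    [ContinuousAdd W] {U : AddSubgroup W} (hU : IsOpen (U : Set W)) {x : W} (hx : x ∉ U) :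
    ∃ χ : AddChar W Circle, Continuous χ ∧ χ x ≠ 1 := by
  have : DiscreteTopology (W ⧸ U) := QuotientAddGroup.discreteTopology hU
  obtain ⟨c, hc⟩ := CharacterModule.exists_character_apply_ne_zero_of_ne_zero
    (mt (QuotientAddGroup.eq_zero_iff x).1 hx)
  let χ : AddChar (W ⧸ U) Circle :=
    AddCircle.toCircle_addChar.compAddMonoidHom (ratCircleToReal.comp (c : _ →+ AddCircle (1 : ℚ)))
  refine ⟨χ.compAddMonoidHom (QuotientAddGroup.mk' U),
    (continuous_of_discreteTopology (f := χ)).comp continuous_quotient_mk', fun h => hc ?_⟩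
  exact ratCircleToReal_injective <| (AddCircle.injective_toCircle one_ne_zero
    (h.trans AddCircle.toCircle_zero.symm)).trans (map_zero _).symm

lemma exists_addChar_ne_one_of_nonarchimedean {W : Type*} [AddCommGroup W] [TopologicalSpace W]
    [NonarchimedeanAddGroup W] [T1Space W] {x : W} (hx : x ≠ 0) :
    ∃ χ : AddChar W Circle, Continuous χ ∧ χ x ≠ 1 := by
  obtain ⟨U, hU⟩ := NonarchimedeanAddGroup.is_nonarchimedean _
    (isOpen_compl_singleton.mem_nhds hx.symm)
  exact exists_addChar_ne_one_of_isOpen U.isOpen fun hxU => hU hxU rfl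

lemma exists_addChar_ne_one_of_finiteDimensional {𝕜 V : Type*} [NontriviallyNormedField 𝕜]
    [CompleteSpace 𝕜] [AddCommGroup V] [TopologicalSpace V] [IsTopologicalAddGroup V] [T2Space V]
    [Module 𝕜 V] [ContinuousSMul 𝕜 V] [FiniteDimensional 𝕜 V]
    {ψ : AddChar 𝕜 Circle} (hψ : Continuous ψ) (hψ₁ : ψ ≠ 1) {x : V} (hx : x ≠ 0) :
    ∃ χ : AddChar V Circle, Continuous χ ∧ χ x ≠ 1 := by
  obtain ⟨c, hc⟩ := AddChar.ne_one_iff.1 hψ₁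
  obtain ⟨f, hf⟩ : ∃ f : V →ₗ[𝕜] 𝕜, f x ≠ 0 := by
    simpa using mt (Module.forall_dual_apply_eq_zero_iff 𝕜 x).1 hx
  let g : V →L[𝕜] 𝕜 := LinearMap.toContinuousLinearMap ((c * (f x)⁻¹) • f)
  have hg : g x = c := by simp [g, hf]
  refine ⟨ψ.compAddMonoidHom (g : V →+ 𝕜), hψ.comp g.continuous, ?_⟩
  rwa [AddChar.compAddMonoidHom_apply, AddMonoidHom.coe_coe, hg]

end SeparatingCharacters

section FiniteDimensional

lemma isProperMap_nsmul_of_charZero (𝕜 : Type*) {V : Type*} [DivisionRing 𝕜] [CharZero 𝕜]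
    [TopologicalSpace V] [AddCommGroup V] [Module 𝕜 V] [ContinuousConstSMul 𝕜 V] {n : ℕ}
    (hn : n ≠ 0) : IsProperMap fun x : V => n • x := by
  simp only [← Nat.cast_smul_eq_nsmul 𝕜]
  exact (Homeomorph.smulOfNeZero (n : 𝕜) (Nat.cast_ne_zero.2 hn)).isProperMap

lemma polishSpace_of_finiteDimensional (𝕜 V : Type*) [NontriviallyNormedField 𝕜] [ProperSpace 𝕜]
    [AddCommGroup V] [TopologicalSpace V] [IsTopologicalAddGroup V] [T2Space V] [Module 𝕜 V]
    [ContinuousSMul 𝕜 V] [FiniteDimensional 𝕜 V] : PolishSpace V :=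
  (Module.finBasis 𝕜 V).equivFunL.toHomeomorph.isClosedEmbedding.polishSpace

namespace IsFiniteDimRealOrPadic

variable {V : Type*} [AddCommGroup V] [TopologicalSpace V]

lemma isProperMap_nsmul (hV : IsFiniteDimRealOrPadic V) {n : ℕ} (hn : n ≠ 0) :
    IsProperMap fun x : V => n • x := by
  rcases hV with ⟨_, _, _⟩ | ⟨p, _, _, _, _⟩
  · exact isProperMap_nsmul_of_charZero ℝ hn
  · exact isProperMap_nsmul_of_charZero ℚ_[p] hn

variable [IsTopologicalAddGroup V] [T2Space V]

lemma polishSpace (hV : IsFiniteDimRealOrPadic V) : PolishSpace V := by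
  rcases hV with ⟨_, _, _⟩ | ⟨p, _, _, _, _⟩
  · exact polishSpace_of_finiteDimensional ℝ V
  · exact polishSpace_of_finiteDimensional ℚ_[p] V

lemma exists_addChar_ne_one (hV : IsFiniteDimRealOrPadic V) {x : V} (hx : x ≠ 0) :
    ∃ χ : AddChar V Circle, Continuous χ ∧ χ x ≠ 1 := by
  rcases hV with ⟨_, _, _⟩ | ⟨p, _, _, _, _⟩
  · exact exists_addChar_ne_one_of_finiteDimensional Real.continuous_probChar
      Real.probChar_ne_one hx
  · obtain ⟨ψ, hψ, hψ₁⟩ := exists_addChar_ne_one_of_nonarchimedean (one_ne_zero (α := ℚ_[p]))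
    exact exists_addChar_ne_one_of_finiteDimensional hψ (AddChar.ne_one_iff.2 ⟨1, hψ₁⟩) hx

end IsFiniteDimRealOrPadic

end FiniteDimensional

section CommutingContractions

variable {V : Type*} [AddCommGroup V]

lemma continuous_of_mem_closure [TopologicalSpace V] {s : Set (AddMonoid.End V)}
    (hs : ∀ f ∈ s, Continuous f) {f : AddMonoid.End V} (hf : f ∈ Submonoid.closure s) :
    Continuous f := by
  induction hf using Submonoid.closure_induction with
  | mem f hf => exact hs f hf
  | one => exact continuous_id
  | mul f g _ _ hf hg => exact hf.comp hg

lemma IsAutophage.exists_eq_convList [TopologicalSpace V] [MeasurableSpace V]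
    [MeasurableAdd₂ V] {μ : Measure V} [SFinite μ] (h : IsAutophage μ) :
    ∃ T : Fin 2 → V ≃ₜ+ V, (∀ i, IsContraction (T i)) ∧ (∀ i j x, T i (T j x) = T j (T i x)) ∧
      μ = convList (List.ofFn fun i => μ.map (T i)) := by
  obtain ⟨T, S, hT, hS, hTS, hμ⟩ := h
  refine ⟨![T, S], Fin.forall_fin_two.2 ⟨hT, hS⟩, Fin.forall_fin_two.2
    ⟨Fin.forall_fin_two.2 ⟨fun _ => rfl, hTS⟩,
      Fin.forall_fin_two.2 ⟨fun x => (hTS x).symm, fun _ => rfl⟩⟩, hμ.trans ?_⟩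
  exact congrArg (μ.map T ∗ ·) (Measure.conv_dirac_zero (μ.map S)).symm

theorem infinitelyDivisible_and_noIdempotentFactors [TopologicalSpace V]
    [IsTopologicalAddGroup V] [PolishSpace V] [MeasurableSpace V] [BorelSpace V] {G : Type*}
    [CommMonoid G] [DistribMulAction G V] [ContinuousConstSMul G V]
    (hproper : ∀ q : ℕ, q.Prime → IsProperMap fun x : V => q • x)
    (hsep : ∀ x : V, x ≠ 0 → ∃ χ : AddChar V Circle, Continuous χ ∧ χ x ≠ 1)
    {m : ℕ} {t : Fin m → G} (ht : ∀ i (x : V), Tendsto (fun n => t i ^ n • x) atTop (𝓝 0))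
    {μ : Measure V} [IsProbabilityMeasure μ]
    (hμ : μ = convList (List.ofFn fun i => μ.map (t i • ·))) :
    InfinitelyDivisible μ ∧ NoIdempotentFactors μ := by
  obtain ⟨μ, rfl⟩ : ∃ ν : ProbabilityMeasure V, (ν : Measure V) = μ := ⟨⟨μ, inferInstance⟩, rfl⟩
  have hfix : (∑ i, push G (t i)) μ = μ := Subtype.ext ((toMeasure_sum_push t μ).trans hμ.symm)
  refine ⟨infinitelyDivisible_toMeasure fun n hn => exists_nsmul_eq ht hproper hn hfix,
    noIdempotentFactors_toMeasure fun ν ρ hνρ hν =>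
      eq_zero_of_add_self_of_characterIntegral_ne_zero hsep (ρ := ρ) (fun χ hχ => ?_) hν⟩
  exact hνρ ▸ characterIntegral_ne_zero ht hfix hχ

end CommutingContractions

end Autophage

open scoped IsMulCommutative in
theorem theorem4p3_general {V : Type*} [AddCommGroup V] [TopologicalSpace V]
    [IsTopologicalAddGroup V] [PolishSpace V] [MeasurableSpace V] [BorelSpace V]
    (hproper : ∀ q : ℕ, q.Prime → IsProperMap fun x : V => q • x)
    (hsep : ∀ x : V, x ≠ 0 → ∃ χ : AddChar V Circle, Continuous χ ∧ χ x ≠ 1)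
    (μ : Measure V) [IsProbabilityMeasure μ] (m : ℕ) (T : Fin m → (V →ₜ+ V))
    (hT : ∀ i x, Tendsto (fun n : ℕ => (⇑(T i))^[n] x) atTop (𝓝 0))
    (hcomm : ∀ i j x, T i (T j x) = T j (T i x))
    (hμ : μ = Autophage.convList (List.ofFn fun i => μ.map (T i))) :
    Autophage.InfinitelyDivisible μ ∧ Autophage.NoIdempotentFactors μ := by
  let G : Submonoid (AddMonoid.End V) := .closure (Set.range fun i => (T i : V →+ V))
  have : IsMulCommutative G := Submonoid.isMulCommutative_closure _ <| by
    rintro _ ⟨i, rfl⟩ _ ⟨j, rfl⟩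
    exact AddMonoidHom.ext (hcomm i j)
  have : ContinuousConstSMul G V := ⟨fun g => Autophage.continuous_of_mem_closure
    (Set.forall_mem_range.2 fun i => (T i).continuous_toFun) g.2⟩
  let t : Fin m → G := fun i => ⟨_, Submonoid.subset_closure ⟨i, rfl⟩⟩
  have ht : ∀ i (x : V), Tendsto (fun n => t i ^ n • x) atTop (𝓝 0) := fun i x =>
    (hT i x).congr fun n => (congrFun (AddMonoid.End.coe_pow V (T i : V →+ V) n) x).symm
  exact Autophage.infinitelyDivisible_and_noIdempotentFactors hproper hsep ht hμ

theorem theorem4p3 {V : Type*} [AddCommGroup V] [TopologicalSpace V] [IsTopologicalAddGroup V]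
    [T2Space V] [MeasurableSpace V] [BorelSpace V]
    (hV : Autophage.IsFiniteDimRealOrPadic V)
    (μ : Measure V) [IsProbabilityMeasure μ] :
    (∀ (m : ℕ) (T : Fin m → (V ≃ₜ+ V)),
      (∀ i, Autophage.IsContraction (T i)) →
      (∀ i j x, T i (T j x) = T j (T i x)) →
      μ = Autophage.convList (List.ofFn fun i => μ.map (T i)) →
      Autophage.InfinitelyDivisible μ ∧ Autophage.NoIdempotentFactors μ) ∧
    (Autophage.IsAutophage μ →
      Autophage.InfinitelyDivisible μ ∧ Autophage.NoIdempotentFactors μ) := by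
  have := hV.polishSpace
  have hmain := fun m (T : Fin m → (V ≃ₜ+ V)) =>
    theorem4p3_general (fun _ hq => hV.isProperMap_nsmul hq.ne_zero)
      (fun _ => hV.exists_addChar_ne_one) μ m fun i => T i
  refine ⟨hmain, fun h => ?_⟩
  obtain ⟨T, hT, hcomm, hμ⟩ := h.exists_eq_convList
  exact hmain 2 T hT hcomm hμ
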